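/- Let $\lambda\in(0,1/2)$ and $s=-\log 2/\log\lambda$. Let $F\subset[0,1]$ be the central Cantor set of ratio $\lambda$: starting from $[0,1]$ (level $0$), every construction interval $[a,a+\lambda^n]$ of level $n$ is replaced by its two subintervals $[a,a+\lambda^{n+1}]$ and $[a+\lambda^n-\lambda^{n+1},a+\lambda^n]$ of level $n+1$, and $F=\bigcap_{n\ge 0}E_n$, where $E_n$ is the union of the intervals of level $n$. A choice of abstract rationals in $F$ is a family $(P(q))_{q\ge 1}$ such that each $P(q)\subseteq F$ is a maximal $(1/q)$-separated subset of $F$, that is, $|p_1-p_2|\ge 1/q$ for all distinct $p_1,p_2\in P(q)$ and no further point of $F$ can be added to $P(q)$ without violating this. For $t\geq 1$ put $$F_t=\{x\in F:\ \text{for infinitely many } q\in\mathbb N \text{ there is } p\in P(q) \text{ with } |p-x|\le q^{-t}\}.$$ Then $\dim_{\mathrm H}F=s$, and there is a choice $P$ of abstract rationals in $F$, each $P(q)$ consisting of endpoints of construction intervals, such that $$\dim_{\mathrm H}F_t=\frac{s}{t}\qquad\text{for all } t\ge 1 .$$ -/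

import Mathlib

open Filter MeasureTheory

/-- `P` is a choice of abstract rationals in the set `F` of a metric space: for every `q ≥ 1`,
`P q` is a maximal `(1/q)`-separated subset of `F`, where `(1/q)`-separated means that distinct
points are at distance at least `1/q`. -/
def IsAbstractRationals {X : Type*} [MetricSpace X] (F : Set X) (P : ℕ → Set X) : Prop :=
  ∀ q : ℕ, 1 ≤ q →
    Maximal (fun S : Set X => S ⊆ F ∧ S.Pairwise fun x y => 1 / (q : ℝ) ≤ dist x y) (P q)

/-- The set `F_t` of points `x` of `F` such that, for infinitely many `q`, there is `p ∈ P q`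
with `d(p, x) ≤ 1 / q ^ t`. -/
def approximableSet {X : Type*} [MetricSpace X] (F : Set X) (P : ℕ → Set X) (t : ℝ) : Set X :=
  {x | x ∈ F ∧ ∃ᶠ q : ℕ in atTop, ∃ p ∈ P q, dist p x ≤ 1 / (q : ℝ) ^ t}

/-- Left endpoints of the construction intervals of level `n` of the central Cantor set of
ratio `lam`. The only interval of level `0` is `[0, 1]`; an interval `[a, a + lam ^ n]` of level
`n` is replaced by its leftmost and its rightmost subinterval of length `lam ^ (n + 1)`. -/
def cantorLeftEndpoints (lam : ℝ) : ℕ → Set ℝ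
  | 0 => {0}
  | n + 1 => ⋃ a ∈ cantorLeftEndpoints lam n, {a, a + lam ^ n - lam ^ (n + 1)}

/-- The central Cantor set of ratio `lam`: the points that lie, for every `n`, in one of the
construction intervals `[a, a + lam ^ n]` of level `n`. -/
def centralCantorSet (lam : ℝ) : Set ℝ :=
  ⋂ n : ℕ, ⋃ a ∈ cantorLeftEndpoints lam n, Set.Icc a (a + lam ^ n)

/-- The endpoints, left and right, of the construction intervals of all levels. -/
def cantorEndpoints (lam : ℝ) : Set ℝ :=
  ⋃ n : ℕ, ⋃ a ∈ cantorLeftEndpoints lam n, {a, a + lam ^ n}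

open scoped ENNReal NNReal Topology

/-! Level `n` has at most `2 ^ n` intervals, of length `lam ^ n`, and `lam ^ s = 1 / 2`. Each `P q`
is chosen inside the left endpoints of one level `N q`, with `lam ^ N q` comparable to `1 / q`.

Upper bound: all `q` with the same `N q = n` share one set of at most `2 ^ n` centres, so a level
contributes that many balls of radius a constant times `lam ^ (t * n)`, however many `q` belong to
it. The sum of `2 ^ n * lam ^ (t * u * n)` converges for `u > s / t` (`dimH_le_of_frequently_near`).

Lower bound: left endpoints of level `n` are more than `lam ^ n` apart, which leaves room for a `q`
whose `P q` is the whole level (`exists_full_levels`). Hence a point whose digits vanish on `[M ^ k,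
t * M ^ k)` for every `k` lies in `F_t`. The other digits are free and have lower density at least
`ρ = (1 - t / M) / t`. Reading them in base 2 gives a Hölder map of exponent `ρ * s` onto a set
containing `[0, 1]`, so the dimension is at least `ρ * s`; then `M → ∞`. The dimension of `F` itself
is the case `t = 1`, since `F_1 = F`. -/

/-! ### Dimension bounds -/

/-- If every point of `A` is, for infinitely many `n`, at distance at most `C * μ ^ n` from one of
the at most `2 ^ n` points of `L n`, then the dimension of `A` is at most any `u` with
`2 * μ ^ u < 1`. -/
theorem dimH_le_of_frequently_near {X : Type*} [MetricSpace X] {L : ℕ → Set X}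
    (hL : ∀ n, (L n).encard ≤ 2 ^ n) {A : Set X} {C μ : ℝ} (hC : 0 ≤ C) (hμ0 : 0 ≤ μ)
    (hμ1 : μ < 1) {u : ℝ≥0} (hu : 2 * μ ^ (u : ℝ) < 1)
    (hA : ∀ x ∈ A, ∃ᶠ n in atTop, ∃ p ∈ L n, dist p x ≤ C * μ ^ n) :
    dimH A ≤ u := by
  borelize X
  apply dimH_le_of_hausdorffMeasure_ne_top
  have hfin : ∀ n, (L n).Finite := fun n =>
    Set.finite_of_encard_le_coe (k := 2 ^ n) (by simpa using hL n)
  have hcount : ∀ n, Countable (L n) := fun n => (hfin n).countable.to_subtype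
  set β : ℝ≥0∞ := 2 * ENNReal.ofReal μ ^ (u : ℝ) with hβ
  have hβ1 : β < 1 := by
    have : β = ENNReal.ofReal (2 * μ ^ (u : ℝ)) := by
      rw [hβ, ENNReal.ofReal_mul (by norm_num), ENNReal.ofReal_rpow_of_nonneg hμ0 u.coe_nonneg]
      simp
    rw [this]
    exact ENNReal.ofReal_lt_one.2 hu
  let D : ℕ → ℝ≥0∞ := fun n => ENNReal.ofReal (2 * C) * ENNReal.ofReal μ ^ n
  have hμ' : ENNReal.ofReal μ < 1 := ENNReal.ofReal_lt_one.2 hμ1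
  have hD : ∀ n (p : X), Metric.ediam (Metric.closedBall p (C * μ ^ n)) ≤ D n := by
    intro n p
    refine Metric.ediam_le fun x hx y hy => ?_
    rw [edist_dist]
    simp only [D]
    rw [← ENNReal.ofReal_pow hμ0, ← ENNReal.ofReal_mul (by positivity)]
    apply ENNReal.ofReal_le_ofReal
    have := dist_triangle_right x y p
    rw [Metric.mem_closedBall] at hx hy
    linarith
  have hDlim : Tendsto D atTop (𝓝 0) := by
    have := ENNReal.Tendsto.const_mul (a := ENNReal.ofReal (2 * C))
      (ENNReal.tendsto_pow_atTop_nhds_zero_of_lt_one hμ') (Or.inr ENNReal.ofReal_ne_top)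
    simpa [D] using this
  have hDanti : Antitone D := fun m n h => mul_le_mul_right (pow_le_pow_of_le_one zero_le hμ'.le h) _
  -- The `k`-th cover takes all balls of levels at least `k`. It covers `A` because closeness recurs
  -- at arbitrarily high levels.
  let ι : ℕ → Type _ := fun k => Σ j : ℕ, L (k + j)
  let T : ∀ k, ι k → Set X := fun k i => Metric.closedBall (i.2 : X) (C * μ ^ (k + i.1))
  have key := Measure.hausdorffMeasure_le_liminf_tsum (u : ℝ) A (l := atTop) D hDlim T
    (Eventually.of_forall fun k i => (hD _ _).trans (hDanti (by omega)))
    (Eventually.of_forall fun k x hx => by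
      obtain ⟨n, hn, p, hp, hpx⟩ := frequently_atTop.1 (hA x hx) k
      obtain ⟨j, rfl⟩ := Nat.exists_eq_add_of_le hn
      exact Set.mem_iUnion.2 ⟨⟨j, p, hp⟩, by
        simpa [T, Metric.mem_closedBall, dist_comm] using hpx⟩)
  refine ne_top_of_le_ne_top ?_ key
  have hterm : ∀ n, (2 : ℝ≥0∞) ^ n * D n ^ (u : ℝ)
      = ENNReal.ofReal (2 * C) ^ (u : ℝ) * β ^ n := by
    intro n
    simp only [D, hβ]
    rw [ENNReal.mul_rpow_of_nonneg _ _ u.coe_nonneg, mul_pow, ← ENNReal.rpow_natCast,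
      ← ENNReal.rpow_natCast (_ ^ (u : ℝ)), ← ENNReal.rpow_natCast, ← ENNReal.rpow_mul,
      ← ENNReal.rpow_mul, mul_comm (u : ℝ) n]
    ring
  have hbound : ∀ k, ∑' i, Metric.ediam (T k i) ^ (u : ℝ)
      ≤ ENNReal.ofReal (2 * C) ^ (u : ℝ) * (1 - β)⁻¹ := by
    intro k
    rw [ENNReal.tsum_sigma', ← ENNReal.tsum_geometric, ← ENNReal.tsum_mul_left]
    refine ENNReal.tsum_le_tsum fun j => ?_
    calc ∑' b : L (k + j), Metric.ediam (T k ⟨j, b⟩) ^ (u : ℝ)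
        ≤ ∑' _ : L (k + j), D (k + j) ^ (u : ℝ) :=
          ENNReal.tsum_le_tsum fun b => ENNReal.rpow_le_rpow (hD _ _) u.coe_nonneg
      _ = ((L (k + j)).encard : ℝ≥0∞) * D (k + j) ^ (u : ℝ) := by
          rw [ENNReal.tsum_const]; rfl
      _ ≤ 2 ^ (k + j) * D (k + j) ^ (u : ℝ) := by
          refine mul_le_mul_left ?_ _
          exact_mod_cast hL (k + j)
      _ = ENNReal.ofReal (2 * C) ^ (u : ℝ) * β ^ (k + j) := hterm _
      _ ≤ _ := mul_le_mul_right (pow_le_pow_of_le_one zero_le hβ1.le (by omega)) _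
  refine ne_top_of_le_ne_top ?_ (liminf_le_of_le (by isBoundedDefault)
    (a := ENNReal.ofReal (2 * C) ^ (u : ℝ) * (1 - β)⁻¹) fun b hb => ?_)
  · refine ENNReal.mul_ne_top (ENNReal.rpow_ne_top_of_nonneg u.coe_nonneg ENNReal.ofReal_ne_top) ?_
    exact ENNReal.inv_ne_top.2 (tsub_pos_of_lt hβ1).ne'
  · obtain ⟨n, hn⟩ := hb.exists
    exact hn.trans (hbound n)

/-- If distances of values of `g` are controlled by the `r`-th power of the distances of values
of `φ`, then `r` times the dimension of the range of `g` is at most that of `φ`. -/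
theorem mul_dimH_range_le {ι X Y : Type*} [MetricSpace X] [MetricSpace Y] {φ : ι → X} {g : ι → Y}
    {C r : ℝ≥0} (hr : 0 < r) (h : ∀ a b, dist (g a) (g b) ≤ C * dist (φ a) (φ b) ^ (r : ℝ)) :
    r * dimH (Set.range g) ≤ dimH (Set.range φ) := by
  rcases isEmpty_or_nonempty ι with hι | hι
  · simp [Set.range_eq_empty]
  -- Points with equal `φ` have equal `g`, because `0 ^ r = 0` for `r > 0`. So `g` factors through
  -- `φ`.
  have hf : ∀ a, g (Function.invFun φ (φ a)) = g a := fun a => by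
    have := h (Function.invFun φ (φ a)) a
    rw [Function.invFun_eq (f := φ) ⟨a, rfl⟩, dist_self, Real.zero_rpow (by positivity), mul_zero] at this
    exact dist_le_zero.1 this
  have hH : HolderOnWith C r (g ∘ Function.invFun φ) (Set.range φ) := by
    rintro _ ⟨a, rfl⟩ _ ⟨b, rfl⟩
    simp only [Function.comp, hf]
    rw [edist_dist, edist_dist, ENNReal.ofReal_rpow_of_nonneg dist_nonneg r.coe_nonneg,
      ← ENNReal.ofReal_coe_nnreal, ← ENNReal.ofReal_mul C.coe_nonneg]
    exact ENNReal.ofReal_le_ofReal (h a b)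
  have himg : (g ∘ Function.invFun φ) '' Set.range φ = Set.range g := by
    rw [← Set.range_comp]
    congr 1
    exact funext hf
  have := hH.dimH_image_le hr
  rw [himg, ENNReal.le_div_iff_mul_le (by simp [hr.ne']) (by simp), mul_comm] at this
  exact this

/-! ### Construction intervals -/

section Cantor

variable {lam : ℝ}

theorem mem_cantorLeftEndpoints_succ {n : ℕ} {b : ℝ} :
    b ∈ cantorLeftEndpoints lam (n + 1) ↔
      ∃ a ∈ cantorLeftEndpoints lam n, b = a ∨ b = a + lam ^ n - lam ^ (n + 1) := by
  simp [cantorLeftEndpoints]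

theorem cantorLeftEndpoints_mono : Monotone (cantorLeftEndpoints lam) :=
  monotone_nat_of_le_succ fun _ a ha => mem_cantorLeftEndpoints_succ.2 ⟨a, ha, Or.inl rfl⟩

theorem encard_cantorLeftEndpoints_le (n : ℕ) : (cantorLeftEndpoints lam n).encard ≤ 2 ^ n := by
  induction n with
  | zero => simp [cantorLeftEndpoints]
  | succ n ih =>
    have : cantorLeftEndpoints lam (n + 1) ⊆ cantorLeftEndpoints lam n ∪
        (fun a => a + lam ^ n - lam ^ (n + 1)) '' cantorLeftEndpoints lam n := by
      intro b hb
      obtain ⟨a, ha, rfl | rfl⟩ := mem_cantorLeftEndpoints_succ.1 hb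
      · exact Or.inl ha
      · exact Or.inr ⟨a, ha, rfl⟩
    calc _ ≤ _ := Set.encard_le_encard this
      _ ≤ _ := Set.encard_union_le _ _
      _ ≤ 2 ^ n + 2 ^ n := add_le_add ih ((Set.encard_image_le _ _).trans ih)
      _ = 2 ^ (n + 1) := by ring

theorem finite_cantorLeftEndpoints (n : ℕ) : (cantorLeftEndpoints lam n).Finite :=
  Set.finite_of_encard_le_coe (k := 2 ^ n) (by simpa using encard_cantorLeftEndpoints_le n)

theorem exists_ancestor (h0 : 0 < lam) (h1 : lam < 1 / 2) (m k : ℕ) {a : ℝ}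
    (ha : a ∈ cantorLeftEndpoints lam (m + k)) :
    ∃ b ∈ cantorLeftEndpoints lam m, b ≤ a ∧ a + lam ^ (m + k) ≤ b + lam ^ m := by
  induction k generalizing a with
  | zero => exact ⟨a, ha, le_rfl, le_rfl⟩
  | succ k ih =>
    obtain ⟨c, hc, hac⟩ := mem_cantorLeftEndpoints_succ.1 ha
    obtain ⟨b, hb, hbc, hcb⟩ := ih hc
    have hp : lam ^ (m + (k + 1)) ≤ lam ^ (m + k) :=
      pow_le_pow_of_le_one h0.le (by linarith) (by omega)
    change a = c ∨ a = c + lam ^ (m + k) - lam ^ (m + (k + 1)) at hac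
    exact ⟨b, hb, by rcases hac with rfl | rfl <;> linarith,
      by rcases hac with rfl | rfl <;> linarith⟩

theorem cantorLeftEndpoints_subset (h0 : 0 < lam) (h1 : lam < 1 / 2) (n : ℕ) :
    cantorLeftEndpoints lam n ⊆ centralCantorSet lam := by
  intro a ha
  refine Set.mem_iInter.2 fun m => ?_
  simp only [Set.mem_iUnion]
  rcases le_total n m with h | h
  · exact ⟨a, cantorLeftEndpoints_mono h ha, le_rfl, by linarith [pow_pos h0 m]⟩
  · obtain ⟨k, rfl⟩ := Nat.exists_eq_add_of_le h
    obtain ⟨b, hb, hba, hab⟩ := exists_ancestor h0 h1 m k ha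
    exact ⟨b, hb, hba, by linarith [pow_pos h0 (m + k)]⟩

/-- The least gap at level `n ≥ 1` is `lam ^ (n - 1) * (1 - lam)`, attained by siblings. The factor
`lam` on the right avoids the exponent `n - 1`. -/
theorem cantorLeftEndpoints_separated (h0 : 0 < lam) (h1 : lam < 1 / 2) (n : ℕ) :
    (cantorLeftEndpoints lam n).Pairwise fun x y => lam ^ n * (1 - lam) ≤ lam * dist x y := by
  induction n with
  | zero => simp [cantorLeftEndpoints]
  | succ n ih =>
    intro b hb b' hb' hne
    obtain ⟨a, ha, hab⟩ := mem_cantorLeftEndpoints_succ.1 hb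
    obtain ⟨a', ha', hab'⟩ := mem_cantorLeftEndpoints_succ.1 hb'
    have hp := pow_pos h0 n
    rw [Real.dist_eq]
    by_cases haa : a = a'
    · subst haa
      have : lam ^ n * (1 - lam) ≤ |b - b'| := by
        rcases hab with rfl | rfl <;> rcases hab' with rfl | rfl
        · exact absurd rfl hne
        · rw [abs_sub_comm]
          refine le_trans (le_of_eq ?_) (le_abs_self _)
          ring
        · refine le_trans (le_of_eq ?_) (le_abs_self _)
          ring
        · exact absurd rfl hne
      calc lam ^ (n + 1) * (1 - lam) = lam * (lam ^ n * (1 - lam)) := by ring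
        _ ≤ _ := by gcongr
    · have hs : lam ^ n * (1 - lam) ≤ lam * dist a a' := ih ha ha' haa
      rw [Real.dist_eq] at hs
      have hb2 : |b - b'| ≥ |a - a'| - lam ^ n * (1 - lam) := by
        have hq : 0 < lam ^ n * (1 - lam) := mul_pos hp (by linarith)
        have : |(a - a') - (b - b')| ≤ lam ^ n * (1 - lam) := by
          rcases hab with rfl | rfl <;> rcases hab' with rfl | rfl <;> rw [abs_le] <;>
            constructor <;> ring_nf at hq ⊢ <;> linarith
        have := abs_sub_abs_le_abs_sub (a - a') (b - b')
        linarith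
      -- Passing to children of distinct parents costs at most one shift `lam ^ n * (1 - lam)`; what
      -- remains suffices because `lam ≤ 1 - lam`.
      calc lam ^ (n + 1) * (1 - lam)
          ≤ lam ^ n * (1 - lam) - lam * (lam ^ n * (1 - lam)) := by
            rw [pow_succ]
            nlinarith [mul_pos hp (show 0 < 1 - lam by linarith)]
        _ ≤ lam * |a - a'| - lam * (lam ^ n * (1 - lam)) := by linarith
        _ ≤ _ := by nlinarith

/-! ### The choice of abstract rationals -/

/-- A finite set of reals has a `δ`-separated subset that meets `[a, a + δ)` for each of its
points `a`. -/
theorem Finset.exists_separated_subset {δ : ℝ} (hδ : 0 < δ) (C : Finset ℝ) :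
    ∃ S ⊆ (C : Set ℝ), (S.Pairwise fun x y => δ ≤ dist x y) ∧
      ∀ a ∈ C, ∃ p ∈ S, a ≤ p ∧ p < a + δ := by
  induction C using Finset.strongInduction with
  | H C ih =>
    rcases C.eq_empty_or_nonempty with rfl | hne
    · exact ⟨∅, by simp⟩
    -- Greedy choice from the right: keep the maximum `c`, which serves every point of `(c - δ, c]`,
    -- and recurse on the rest.
    set c := C.max' hne with hc
    have hcC : c ∈ C := C.max'_mem hne
    obtain ⟨S, hSC, hsep, hS⟩ := ih (C.filter fun a => a ≤ c - δ)
      (Finset.filter_ssubset.2 ⟨c, hcC, by linarith⟩)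
    have hSle : ∀ a ∈ S, a ∈ C ∧ a ≤ c - δ := fun a ha => by simpa using hSC ha
    refine ⟨insert c S, Set.insert_subset hcC fun a ha => (hSle a ha).1, ?_, fun a ha => ?_⟩
    · refine hsep.insert fun b hb _ => ?_
      have := (hSle b hb).2
      have hd : δ ≤ dist c b := by
        rw [Real.dist_eq]
        exact le_trans (by linarith) (le_abs_self _)
      exact ⟨hd, dist_comm c b ▸ hd⟩
    · by_cases h : a ≤ c - δ
      · obtain ⟨p, hp, hap⟩ := hS a (by simp [ha, h])
        exact ⟨p, Or.inr hp, hap⟩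
      · exact ⟨c, Or.inl rfl, C.le_max' a ha, by linarith⟩

/-- A separated set of left endpoints of level `n` that meets `[a, a + δ)` for each left endpoint
`a` of level `n` is maximal among the `δ`-separated subsets of the Cantor set if `lam ^ n < δ`. -/
theorem maximal_separated_of_endpoints (h0 : 0 < lam) (h1 : lam < 1 / 2) {n : ℕ} {δ : ℝ}
    (hδ : lam ^ n < δ) {S : Set ℝ} (hS : S ⊆ cantorLeftEndpoints lam n)
    (hsep : S.Pairwise fun x y => δ ≤ dist x y)
    (hmeet : ∀ a ∈ cantorLeftEndpoints lam n, ∃ p ∈ S, a ≤ p ∧ p < a + δ) :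
    Maximal (fun S : Set ℝ => S ⊆ centralCantorSet lam ∧ S.Pairwise fun x y => δ ≤ dist x y) S := by
  refine ⟨⟨hS.trans (cantorLeftEndpoints_subset h0 h1 n), hsep⟩, fun S' ⟨hS', hsep'⟩ hle x hx => ?_⟩
  have hxn := Set.mem_iInter.1 (hS' hx) n
  simp only [Set.mem_iUnion] at hxn
  obtain ⟨a, ha, hax, hxa⟩ := hxn
  obtain ⟨p, hp, hap, hpa⟩ := hmeet a ha
  by_contra hxS
  have hne : p ≠ x := fun h => hxS (h ▸ hp)
  have hd : δ ≤ dist p x := hsep' (hle hp) hx hne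
  rw [Real.dist_eq] at hd
  have : |p - x| < δ := abs_sub_lt_iff.2 ⟨by linarith, by linarith⟩
  linarith

/-- A choice of abstract rationals whose `q`-th set consists of left endpoints of a level `N q`
with `lam ^ (N q)` comparable to `1 / q`, and is the set of all of them if they are separated. -/
theorem exists_abstractRationals (h0 : 0 < lam) (h1 : lam < 1 / 2) :
    ∃ (P : ℕ → Set ℝ) (N : ℕ → ℕ), IsAbstractRationals (centralCantorSet lam) P ∧
      ∀ q : ℕ, 1 ≤ q → P q ⊆ cantorLeftEndpoints lam (N q) ∧ lam ^ N q < 1 / q ∧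
        lam * (1 / q) ≤ lam ^ N q ∧
        (((cantorLeftEndpoints lam (N q)).Pairwise fun x y => 1 / (q : ℝ) ≤ dist x y) →
          P q = cantorLeftEndpoints lam (N q)) := by
  have hex : ∀ q : ℕ, ∃ (S : Set ℝ) (n : ℕ), 1 ≤ q →
      Maximal (fun S : Set ℝ => S ⊆ centralCantorSet lam ∧
        S.Pairwise fun x y => 1 / (q : ℝ) ≤ dist x y) S ∧
      S ⊆ cantorLeftEndpoints lam n ∧ lam ^ n < 1 / q ∧ lam * (1 / q) ≤ lam ^ n ∧
      (((cantorLeftEndpoints lam n).Pairwise fun x y => 1 / (q : ℝ) ≤ dist x y) →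
          S = cantorLeftEndpoints lam n) := by
    intro q
    rcases Nat.eq_zero_or_pos q with rfl | hq
    · exact ⟨∅, 0, by simp⟩
    have hq0 : (0 : ℝ) < q := by exact_mod_cast hq
    have hδ : (0 : ℝ) < 1 / q := by positivity
    have hNex := exists_pow_lt_of_lt_one hδ (show lam < 1 by linarith)
    classical
    -- Minimality of `n` gives the lower bound `lam / q ≤ lam ^ n`.
    set n := Nat.find hNex
    have hn : lam ^ n < 1 / q := Nat.find_spec hNex
    have hn' : lam * (1 / q) ≤ lam ^ n := by
      rcases Nat.eq_zero_or_pos n with hz | hz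
      · exfalso
        rw [hz, pow_zero, lt_div_iff₀ hq0, one_mul] at hn
        have : (1 : ℝ) ≤ q := by exact_mod_cast hq
        linarith
      · have := Nat.find_min hNex (show n - 1 < n by omega)
        rw [not_lt] at this
        calc lam * (1 / q) ≤ lam * lam ^ (n - 1) := by gcongr
          _ = lam ^ n := by rw [← pow_succ', Nat.sub_add_cancel hz]
    obtain ⟨S, hSC, hsep, hS⟩ :=
      Finset.exists_separated_subset hδ (finite_cantorLeftEndpoints (lam := lam) n).toFinset
    simp only [Set.Finite.coe_toFinset, Set.Finite.mem_toFinset] at hSC hS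
    refine ⟨S, n, fun _ => ⟨maximal_separated_of_endpoints h0 h1 hn hSC hsep hS, hSC, hn, hn',
      fun hL => hSC.antisymm fun a ha => ?_⟩⟩
    obtain ⟨p, hp, hap, hpa⟩ := hS a ha
    by_contra haS
    have hd : 1 / (q : ℝ) ≤ dist p a := hL (hSC hp) ha fun h => haS (h ▸ hp)
    rw [Real.dist_eq, abs_of_nonneg (by linarith)] at hd
    linarith
  choose P N h using hex
  exact ⟨P, N, fun q hq => (h q hq).1, fun q hq => (h q hq).2⟩

/-! ### Coding of the Cantor set -/

/-- The point of the central Cantor set with a given sequence of choices: digit `0` stands for the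
left and digit `1` for the right subinterval. -/
noncomputable def cantorPoint (lam : ℝ) (x : ℕ → Fin 2) : ℝ :=
  ∑' i, ((x i : ℕ) : ℝ) * ((1 - lam) * lam ^ i)

/-- The left endpoint of the construction interval of level `n` given by the first `n` choices. -/
noncomputable def cantorPrefix (lam : ℝ) (x : ℕ → Fin 2) (n : ℕ) : ℝ :=
  ∑ i ∈ Finset.range n, ((x i : ℕ) : ℝ) * ((1 - lam) * lam ^ i)

theorem cantorPrefix_mem (x : ℕ → Fin 2) (n : ℕ) :
    cantorPrefix lam x n ∈ cantorLeftEndpoints lam n := by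
  induction n with
  | zero => simp [cantorPrefix, cantorLeftEndpoints]
  | succ n ih =>
    refine mem_cantorLeftEndpoints_succ.2 ⟨_, ih, ?_⟩
    rw [cantorPrefix, Finset.sum_range_succ, ← cantorPrefix]
    have : ∀ d : Fin 2, d = 0 ∨ d = 1 := by decide
    rcases this (x n) with h | h
    · left; simp [h]
    · right; simp only [h, Fin.val_one, Nat.cast_one]; ring

theorem cantorPoint_term_le (h0 : 0 < lam) (h1 : lam < 1 / 2) (x : ℕ → Fin 2) (i : ℕ) :
    ((x i : ℕ) : ℝ) * ((1 - lam) * lam ^ i) ≤ (1 - lam) * lam ^ i := by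
  have : ((x i : ℕ) : ℝ) ≤ 1 := by exact_mod_cast Nat.le_of_lt_succ (x i).2
  have h : 0 ≤ (1 - lam) * lam ^ i := mul_nonneg (by linarith) (pow_nonneg h0.le _)
  exact mul_le_of_le_one_left h this

theorem cantorPoint_term_nonneg (h0 : 0 < lam) (h1 : lam < 1 / 2) (x : ℕ → Fin 2) (i : ℕ) :
    0 ≤ ((x i : ℕ) : ℝ) * ((1 - lam) * lam ^ i) :=
  mul_nonneg (Nat.cast_nonneg _) (mul_nonneg (by linarith) (pow_nonneg h0.le _))

theorem hasSum_gap (h0 : 0 < lam) (h1 : lam < 1 / 2) :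
    HasSum (fun i => (1 - lam) * lam ^ i) 1 := by
  have := (hasSum_geometric_of_lt_one h0.le (show lam < 1 by linarith)).mul_left (1 - lam)
  rwa [mul_inv_cancel₀ (by linarith)] at this

theorem summable_cantorPoint (h0 : 0 < lam) (h1 : lam < 1 / 2) (x : ℕ → Fin 2) :
    Summable fun i => ((x i : ℕ) : ℝ) * ((1 - lam) * lam ^ i) :=
  (hasSum_gap h0 h1).summable.of_nonneg_of_le (cantorPoint_term_nonneg h0 h1 x)
    (cantorPoint_term_le h0 h1 x)

theorem cantorPoint_mem_Icc_zero_one (h0 : 0 < lam) (h1 : lam < 1 / 2) (x : ℕ → Fin 2) :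
    cantorPoint lam x ∈ Set.Icc 0 1 :=
  ⟨tsum_nonneg (cantorPoint_term_nonneg h0 h1 x), by
    rw [← (hasSum_gap h0 h1).tsum_eq]
    exact (summable_cantorPoint h0 h1 x).tsum_le_tsum (cantorPoint_term_le h0 h1 x)
      (hasSum_gap h0 h1).summable⟩

theorem cantorPoint_eq_prefix_add (h0 : 0 < lam) (h1 : lam < 1 / 2) (x : ℕ → Fin 2) (n : ℕ) :
    cantorPoint lam x = cantorPrefix lam x n + lam ^ n * cantorPoint lam fun i => x (i + n) := by
  rw [cantorPoint, ← (summable_cantorPoint h0 h1 x).sum_add_tsum_nat_add n, cantorPrefix,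
    cantorPoint, ← tsum_mul_left]
  congr 1
  refine tsum_congr fun i => ?_
  rw [pow_add]
  ring

theorem cantorPoint_mem_Icc (h0 : 0 < lam) (h1 : lam < 1 / 2) (x : ℕ → Fin 2) (n : ℕ) :
    cantorPoint lam x ∈ Set.Icc (cantorPrefix lam x n) (cantorPrefix lam x n + lam ^ n) := by
  rw [cantorPoint_eq_prefix_add h0 h1 x n]
  obtain ⟨ha, hb⟩ := cantorPoint_mem_Icc_zero_one h0 h1 fun i => x (i + n)
  have hp := pow_pos h0 n
  exact ⟨by nlinarith, by nlinarith⟩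

theorem cantorPoint_mem (h0 : 0 < lam) (h1 : lam < 1 / 2) (x : ℕ → Fin 2) :
    cantorPoint lam x ∈ centralCantorSet lam := by
  refine Set.mem_iInter.2 fun n => ?_
  simp only [Set.mem_iUnion]
  exact ⟨_, cantorPrefix_mem x n, cantorPoint_mem_Icc h0 h1 x n⟩

/-- Zero digits are left choices, so the left endpoint does not move between levels `n` and `m`. -/
theorem dist_cantorPrefix_le (h0 : 0 < lam) (h1 : lam < 1 / 2) {x : ℕ → Fin 2} {n m : ℕ}
    (hnm : n ≤ m) (hx : ∀ i, n ≤ i → i < m → x i = 0) :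
    dist (cantorPrefix lam x n) (cantorPoint lam x) ≤ lam ^ m := by
  have : cantorPrefix lam x m = cantorPrefix lam x n := by
    rw [cantorPrefix, ← Finset.sum_range_add_sum_Ico _ hnm, ← cantorPrefix, add_eq_left]
    refine Finset.sum_eq_zero fun i hi => ?_
    rw [Finset.mem_Ico] at hi
    simp [hx i hi.1 hi.2]
  rw [← this, Real.dist_eq, abs_sub_le_iff]
  obtain ⟨ha, hb⟩ := cantorPoint_mem_Icc h0 h1 x m
  exact ⟨by linarith [pow_pos h0 m], by linarith⟩

/-- The points lie in sibling intervals of level `m + 1`, and the gap between these is `lam ^ m - 2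
* lam ^ (m + 1)`. -/
theorem le_dist_cantorPoint (h0 : 0 < lam) (h1 : lam < 1 / 2) {x y : ℕ → Fin 2} {m : ℕ}
    (hlt : ∀ i < m, x i = y i) (hm : x m ≠ y m) :
    lam ^ m * (1 - 2 * lam) ≤ dist (cantorPoint lam x) (cantorPoint lam y) := by
  have hpre : cantorPrefix lam x m = cantorPrefix lam y m :=
    Finset.sum_congr rfl fun i hi => by rw [hlt i (Finset.mem_range.1 hi)]
  have hsucc : ∀ z : ℕ → Fin 2, cantorPrefix lam z (m + 1) =
      cantorPrefix lam z m + ((z m : ℕ) : ℝ) * ((1 - lam) * lam ^ m) := fun z =>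
    Finset.sum_range_succ _ _
  obtain ⟨hx1, hx2⟩ := cantorPoint_mem_Icc h0 h1 x (m + 1)
  obtain ⟨hy1, hy2⟩ := cantorPoint_mem_Icc h0 h1 y (m + 1)
  rw [hsucc, pow_succ] at hx2 hy2
  rw [hsucc] at hx1 hy1
  rw [hpre] at hx1 hx2
  have h01 : ∀ a b : Fin 2, a ≠ b → (a = 0 ∧ b = 1) ∨ (a = 1 ∧ b = 0) := by decide
  rw [Real.dist_eq]
  rcases h01 _ _ hm with ⟨ha, hb⟩ | ⟨ha, hb⟩
  · rw [abs_sub_comm]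
    refine le_trans ?_ (le_abs_self _)
    simp only [ha, hb, Fin.val_zero, Fin.val_one, Nat.cast_zero, Nat.cast_one] at *
    linarith
  · refine le_trans ?_ (le_abs_self _)
    simp only [ha, hb, Fin.val_zero, Fin.val_one, Nat.cast_zero, Nat.cast_one] at *
    linarith

end Cantor

/-! ### Sequences with prescribed zeros -/

section Digits

/-- Spread a sequence of digits over the positions satisfying `p`, with `0` elsewhere. -/
def spreadDigits (p : ℕ → Prop) [DecidablePred p] (d : ℕ → Fin 2) (i : ℕ) : Fin 2 :=
  if p i then d (Nat.count p i) else 0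

theorem eq_of_spreadDigits_eq {p : ℕ → Prop} [DecidablePred p] {d e : ℕ → Fin 2} {m : ℕ}
    (h : ∀ i < m, spreadDigits p d i = spreadDigits p e i) {j : ℕ} (hj : j < Nat.count p m) :
    d j = e j := by
  -- The digit `d j` sits at position `Nat.nth p j`. If `p` holds only finitely often, this bound
  -- keeps `Nat.nth` away from its default value.
  have hcard : ∀ hf : (Set.ofPred p).Finite, j < hf.toFinset.card := fun hf =>
    hj.trans_le (Nat.count_le_card hf m)
  have := h _ (Nat.nth_lt_of_lt_count hj)
  simpa [spreadDigits, Nat.nth_mem _ hcard, Nat.count_nth hcard] using this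

/-- The positions outside the blocks `[M ^ k, t * M ^ k)`. -/
def IsFreePosition (M : ℕ) (t : ℝ) (i : ℕ) : Prop :=
  ∀ k : ℕ, ¬(M ^ k ≤ i ∧ i < ⌈t * (M : ℝ) ^ k⌉₊)

/-- For `M ^ k ≤ m < M ^ (k + 1)` it suffices to count the free positions between blocks `k - 1` and
`k` and those after block `k`. The density is worst at `m = t * M ^ k`, the end of a block; the loss
of `2` pays for two ceilings. -/
theorem le_count_isFreePosition {M : ℕ} (hM : 2 ≤ M) {t : ℝ} (ht : 1 ≤ t) (htM : t ≤ M)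
    [DecidablePred (IsFreePosition M t)] (m : ℕ) :
    (1 - t / M) / t * m - 2 ≤ Nat.count (IsFreePosition M t) m := by
  have ht0 : 0 < t := by linarith
  have hM0 : (0 : ℝ) < M := by linarith
  rcases Nat.eq_zero_or_pos m with rfl | hm
  · simp
  obtain ⟨k, hk, hk'⟩ : ∃ k, M ^ k ≤ m ∧ m < M ^ (k + 1) :=
    ⟨Nat.log M m, Nat.pow_log_le_self M hm.ne', Nat.lt_pow_succ_log_self (by omega) m⟩
  set a : ℕ := ⌈t / M * (M : ℝ) ^ k⌉₊ with ha
  set b : ℕ := ⌈t * (M : ℝ) ^ k⌉₊ with hb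
  have hMb : M ^ k ≤ b := by
    have : ((M ^ k : ℕ) : ℝ) ≤ b := by
      push_cast
      exact le_trans (le_mul_of_one_le_left (by positivity) ht) (Nat.le_ceil _)
    exact_mod_cast this
  have hdisj : Disjoint (Finset.Ico a (M ^ k)) (Finset.Ico b m) := by
    rw [Finset.disjoint_left]
    intro i hi hi'
    rw [Finset.mem_Ico] at hi hi'
    omega
  have hsub : Finset.Ico a (M ^ k) ∪ Finset.Ico b m ⊆
      (Finset.range m).filter (IsFreePosition M t) := by
    intro i hi
    rw [Finset.mem_union, Finset.mem_Ico, Finset.mem_Ico] at hi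
    rw [Finset.mem_filter, Finset.mem_range]
    refine ⟨by omega, fun l ⟨hl, hl'⟩ => ?_⟩
    rcases hi with ⟨hai, hik⟩ | ⟨hbi, him⟩
    · have hlk : l < k := (Nat.pow_lt_pow_iff_right (by omega)).1 (hl.trans_lt hik)
      have : ⌈t * (M : ℝ) ^ l⌉₊ ≤ a := by
        apply Nat.ceil_le_ceil
        obtain ⟨j, rfl⟩ : ∃ j, k = j + 1 := ⟨k - 1, by omega⟩
        rw [pow_succ', ← mul_assoc, div_mul_cancel₀ _ hM0.ne']
        gcongr
        · linarith
        · omega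
      omega
    · have hlk : l < k + 1 :=
        (Nat.pow_lt_pow_iff_right (by omega)).1 (hl.trans_lt (him.trans hk'))
      have : ⌈t * (M : ℝ) ^ l⌉₊ ≤ b := by
        apply Nat.ceil_le_ceil
        gcongr
        · linarith
        · omega
      omega
  have hcard : (M ^ k - a) + (m - b) ≤ Nat.count (IsFreePosition M t) m := by
    have := Finset.card_le_card hsub
    rwa [Finset.card_union_of_disjoint hdisj, Nat.card_Ico, Nat.card_Ico,
      ← Nat.count_eq_card_filter_range] at this
  have h1 : (M : ℝ) ^ k ≤ ((M ^ k - a : ℕ) : ℝ) + a := by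
    have : M ^ k ≤ (M ^ k - a) + a := by omega
    exact_mod_cast this
  have h2 : (m : ℝ) ≤ ((m - b : ℕ) : ℝ) + b := by
    have : m ≤ (m - b) + b := by omega
    exact_mod_cast this
  have h3 : ((M ^ k - a : ℕ) : ℝ) + ((m - b : ℕ) : ℝ) ≤ Nat.count (IsFreePosition M t) m := by
    exact_mod_cast hcard
  have h4 : (0 : ℝ) ≤ ((m - b : ℕ) : ℝ) := Nat.cast_nonneg _
  have ha' : (a : ℝ) < t / M * (M : ℝ) ^ k + 1 := Nat.ceil_lt_add_one (by positivity)
  have hb' : (b : ℝ) < t * (M : ℝ) ^ k + 1 := Nat.ceil_lt_add_one (by positivity)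
  set A : ℝ := (M : ℝ) ^ k
  have hc0 : 0 ≤ 1 - t / M := by rw [sub_nonneg, div_le_one hM0]; exact htM
  have hc1 : 1 - t / M ≤ 1 := by linarith [div_pos ht0 hM0]
  set c : ℝ := 1 - t / M
  have hcA : t / M * A = A - c * A := by simp only [c]; ring
  rw [hcA] at ha'
  -- Expansion around the worst case `m = t * A`: before it the correction is nonpositive, after it
  -- the slope `c / t ≤ 1` is beaten by the new free positions.
  have hct : c / t * m = c * A + c / t * (m - t * A) := by field_simp; ring
  rw [hct]
  rcases le_total (m : ℝ) (t * A) with h | h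
  · have : c / t * (m - t * A) ≤ 0 :=
      mul_nonpos_of_nonneg_of_nonpos (by positivity) (by linarith)
    linarith
  · have : c / t * (m - t * A) ≤ 1 * (m - t * A) := by
      refine mul_le_mul_of_nonneg_right ?_ (by linarith)
      rw [div_le_one ht0]
      linarith
    linarith

end Digits

/-! ### Dimension of the sets of well approximable points -/

section Dimension

variable {lam s : ℝ}

theorem rpow_eq_half (h0 : 0 < lam) (h1 : lam < 1 / 2) (hs : s = -Real.log 2 / Real.log lam) :
    lam ^ s = 1 / 2 := by
  have hl : Real.log lam < 0 := Real.log_neg h0 (by linarith)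
  rw [Real.rpow_def_of_pos h0, hs, mul_div_cancel₀ _ hl.ne, Real.exp_neg, Real.exp_log two_pos,
    one_div]

theorem cantor_exponent_pos (h0 : 0 < lam) (h1 : lam < 1 / 2)
    (hs : s = -Real.log 2 / Real.log lam) : 0 < s :=
  hs ▸ div_pos_of_neg_of_neg (neg_lt_zero.2 (Real.log_pos one_lt_two))
    (Real.log_neg h0 (by linarith))

theorem dimH_approximableSet_le (h0 : 0 < lam) (h1 : lam < 1 / 2)
    (hs : s = -Real.log 2 / Real.log lam) {P : ℕ → Set ℝ} {N : ℕ → ℕ}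
    (hPN : ∀ q : ℕ, 1 ≤ q → P q ⊆ cantorLeftEndpoints lam (N q) ∧ lam ^ N q < 1 / q ∧
      lam * (1 / q) ≤ lam ^ N q) {t : ℝ} (ht : 1 ≤ t) :
    dimH (approximableSet (centralCantorSet lam) P t) ≤ ENNReal.ofReal (s / t) := by
  have ht0 : 0 < t := by linarith
  have hl1 : lam < 1 := by linarith
  have hspos := cantor_exponent_pos h0 h1 hs
  refine le_of_forall_gt_imp_ge_of_dense fun v hv => ?_
  rcases eq_or_ne v ⊤ with rfl | hvtop
  · exact le_top
  lift v to ℝ≥0 using hvtop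
  have hv' : s / t < v := by
    rwa [← ENNReal.ofReal_coe_nnreal, ENNReal.ofReal_lt_ofReal_iff_of_nonneg (by positivity)] at hv
  have hNlim : Tendsto N atTop atTop := by
    refine tendsto_atTop.2 fun n => ?_
    have hlim : Tendsto (fun q : ℕ => 1 / (q : ℝ)) atTop (𝓝 0) :=
      tendsto_one_div_atTop_nhds_zero_nat
    filter_upwards [hlim.eventually_lt_const (pow_pos h0 n), eventually_ge_atTop 1] with q hq hq1
    exact ((pow_lt_pow_iff_right_of_lt_one₀ h0 hl1).1 ((hPN q hq1).2.1.trans hq)).le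
  refine dimH_le_of_frequently_near (encard_cantorLeftEndpoints_le (lam := lam))
    (C := (1 / lam) ^ t) (μ := lam ^ t) (by positivity) (by positivity)
    (Real.rpow_lt_one h0.le hl1 ht0) ?_ fun x hx => ?_
  · have : lam ^ (t * v) < lam ^ s := by
      refine Real.rpow_lt_rpow_of_exponent_gt h0 hl1 ?_
      rwa [div_lt_iff₀' ht0] at hv'
    rw [rpow_eq_half h0 h1 hs] at this
    rw [← Real.rpow_mul h0.le]
    linarith
  -- Infinitely many `q` give infinitely many levels because `N` tends to infinity.
  · refine hNlim.frequently ((hx.2.and_eventually (eventually_ge_atTop 1)).mono ?_)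
    rintro q ⟨⟨p, hp, hpx⟩, hq⟩
    obtain ⟨hP, -, hN⟩ := hPN q hq
    refine ⟨p, hP hp, hpx.trans ?_⟩
    have hq0 : (0 : ℝ) < q := by exact_mod_cast hq
    calc 1 / (q : ℝ) ^ t = (1 / (q : ℝ)) ^ t := by
          rw [Real.div_rpow zero_le_one hq0.le, Real.one_rpow]
      _ ≤ (1 / lam * lam ^ N q) ^ t := by
          refine Real.rpow_le_rpow (by positivity) ?_ ht0.le
          rw [div_mul_eq_mul_div, one_mul, le_div_iff₀ h0, mul_comm]
          exact hN
      _ = (1 / lam) ^ t * (lam ^ t) ^ N q := by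
          rw [Real.mul_rpow (by positivity) (by positivity), Real.rpow_pow_comm h0.le]

/-- For all large `n`, some `q` with `lam ^ n < 1 / q` uses all left endpoints of level `n`. -/
theorem exists_full_levels (h0 : 0 < lam) (h1 : lam < 1 / 2) {P : ℕ → Set ℝ} {N : ℕ → ℕ}
    (hPN : ∀ q : ℕ, 1 ≤ q → P q ⊆ cantorLeftEndpoints lam (N q) ∧ lam ^ N q < 1 / q ∧
      lam * (1 / q) ≤ lam ^ N q ∧
      (((cantorLeftEndpoints lam (N q)).Pairwise fun x y => 1 / (q : ℝ) ≤ dist x y) →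
        P q = cantorLeftEndpoints lam (N q))) :
    ∃ Q : ℕ → ℕ, Tendsto Q atTop atTop ∧
      ∀ᶠ n in atTop, 1 ≤ Q n ∧ P (Q n) = cantorLeftEndpoints lam n ∧ lam ^ n < 1 / Q n := by
  have hl1 : lam < 1 := by linarith
  have hlam : 0 < 1 - lam := by linarith
  -- The least `q` for which `1 / q` does not exceed the separation of level `n`.
  let Q : ℕ → ℕ := fun n => ⌈lam / (1 - lam) * (lam ^ n)⁻¹⌉₊
  have hinv : Tendsto (fun n => (lam ^ n)⁻¹) atTop atTop := by
    simp_rw [← inv_pow]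
    exact tendsto_pow_atTop_atTop_of_one_lt ((one_lt_inv₀ h0).2 hl1)
  refine ⟨Q, tendsto_nat_ceil_atTop.comp (hinv.const_mul_atTop (by positivity)), ?_⟩
  -- This is where `lam < 1 / 2` leaves room: for large `n` the slack before `(lam ^ n)⁻¹` exceeds
  -- `1` and absorbs the ceiling.
  have hlt : 0 < 1 - lam / (1 - lam) := by
    rw [sub_pos, div_lt_one hlam]
    linarith
  filter_upwards [(hinv.const_mul_atTop hlt).eventually_ge_atTop 1] with n hn
  have hp := pow_pos h0 n
  have hx : 0 < lam / (1 - lam) * (lam ^ n)⁻¹ := by positivity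
  have hQ1 : 1 ≤ Q n := Nat.one_le_ceil_iff.2 hx
  have hQ0 : (0 : ℝ) < Q n := by exact_mod_cast hQ1
  have hQlt : (Q n : ℝ) < (lam ^ n)⁻¹ := by
    have := Nat.ceil_lt_add_one hx.le
    linarith
  have hQle : lam * (1 / Q n) ≤ lam ^ n * (1 - lam) := by
    have := Nat.le_ceil (lam / (1 - lam) * (lam ^ n)⁻¹)
    change _ ≤ (Q n : ℝ) at this
    rw [← div_eq_mul_inv, div_div, div_le_iff₀ (by positivity)] at this
    rw [mul_one_div, div_le_iff₀ hQ0]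
    linarith
  have hlow : lam ^ n < 1 / Q n := by
    rw [lt_div_iff₀ hQ0, ← lt_div_iff₀' hp, one_div]
    exact hQlt
  obtain ⟨-, hN1, hN2, hfull⟩ := hPN (Q n) hQ1
  have hNn : N (Q n) = n := by
    apply le_antisymm
    · have : lam ^ (n + 1) < lam ^ N (Q n) := by
        rw [pow_succ']
        exact (mul_lt_mul_of_pos_left hlow h0).trans_le hN2
      have := (pow_lt_pow_iff_right_of_lt_one₀ h0 hl1).1 this
      omega
    · have : lam ^ (N (Q n) + 1) < lam ^ n := by
        rw [pow_succ']
        refine (mul_lt_mul_of_pos_left hN1 h0).trans_le (hQle.trans ?_)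
        exact mul_le_of_le_one_right hp.le (by linarith)
      have := (pow_lt_pow_iff_right_of_lt_one₀ h0 hl1).1 this
      omega
  refine ⟨hQ1, ?_, hlow⟩
  rw [hNn] at hfull
  refine hfull fun a ha b hb hab => ?_
  have : lam ^ n * (1 - lam) ≤ lam * dist a b := cantorLeftEndpoints_separated h0 h1 n ha hb hab
  exact le_of_mul_le_mul_left (hQle.trans this) h0

theorem cantorPoint_spreadDigits_mem (h0 : 0 < lam) (h1 : lam < 1 / 2) {P : ℕ → Set ℝ} {N : ℕ → ℕ}
    (hPN : ∀ q : ℕ, 1 ≤ q → P q ⊆ cantorLeftEndpoints lam (N q) ∧ lam ^ N q < 1 / q ∧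
      lam * (1 / q) ≤ lam ^ N q ∧
      (((cantorLeftEndpoints lam (N q)).Pairwise fun x y => 1 / (q : ℝ) ≤ dist x y) →
        P q = cantorLeftEndpoints lam (N q)))
    {t : ℝ} (ht : 1 ≤ t) {M : ℕ} (hM : 2 ≤ M) [DecidablePred (IsFreePosition M t)]
    (d : ℕ → Fin 2) :
    cantorPoint lam (spreadDigits (IsFreePosition M t) d) ∈
      approximableSet (centralCantorSet lam) P t := by
  refine ⟨cantorPoint_mem h0 h1 _, ?_⟩
  obtain ⟨Q, hQ, hfull⟩ := exists_full_levels h0 h1 hPN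
  have hMlim : Tendsto (fun k => M ^ k) atTop atTop :=
    tendsto_pow_atTop_atTop_of_one_lt (by omega)
  -- The approximating `q` are `Q (M ^ k)`, and the approximants are the left endpoints at which the
  -- zero blocks start.
  refine (hQ.comp hMlim).frequently (Eventually.frequently ?_)
  filter_upwards [hMlim.eventually hfull] with k hk
  obtain ⟨hQ1, hP, hlow⟩ := hk
  have hQ0 : (0 : ℝ) < Q (M ^ k) := by exact_mod_cast hQ1
  refine ⟨_, hP ▸ cantorPrefix_mem (spreadDigits (IsFreePosition M t) d) _, ?_⟩
  have hceil : M ^ k ≤ ⌈t * (M : ℝ) ^ k⌉₊ := by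
    have : ((M ^ k : ℕ) : ℝ) ≤ ⌈t * (M : ℝ) ^ k⌉₊ := by
      push_cast
      exact le_trans (le_mul_of_one_le_left (by positivity) ht) (Nat.le_ceil _)
    exact_mod_cast this
  refine (dist_cantorPrefix_le h0 h1 hceil fun i hi hi' => ?_).trans ?_
  · exact if_neg fun hfree => hfree k ⟨hi, hi'⟩
  · calc lam ^ ⌈t * (M : ℝ) ^ k⌉₊ = lam ^ ((⌈t * (M : ℝ) ^ k⌉₊ : ℕ) : ℝ) :=
          (Real.rpow_natCast _ _).symm
      _ ≤ lam ^ (t * (M : ℝ) ^ k) :=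
          Real.rpow_le_rpow_of_exponent_ge h0 (by linarith) (Nat.le_ceil _)
      _ = (lam ^ (M ^ k)) ^ t := by
          rw [mul_comm, Real.rpow_mul h0.le, ← Real.rpow_natCast lam (M ^ k)]
          push_cast
          rfl
      _ ≤ (1 / (Q (M ^ k) : ℝ)) ^ t :=
          Real.rpow_le_rpow (by positivity) hlow.le (by linarith)
      _ = 1 / (Q (M ^ k) : ℝ) ^ t := by
          rw [Real.div_rpow zero_le_one hQ0.le, Real.one_rpow]

/-- The dimension of the set of points coded by sequences with prescribed zeros, when the number
of free positions below `m` is at least about `ρ * m`. -/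
theorem le_dimH_range_cantorPoint_spreadDigits (h0 : 0 < lam) (h1 : lam < 1 / 2)
    (hs : s = -Real.log 2 / Real.log lam) {p : ℕ → Prop} [DecidablePred p] {ρ c : ℝ} (hρ : 0 < ρ)
    (hcount : ∀ m : ℕ, ρ * m - c ≤ Nat.count p m) :
    ENNReal.ofReal (ρ * s) ≤ dimH (Set.range fun d => cantorPoint lam (spreadDigits p d)) := by
  have hspos := cantor_exponent_pos h0 h1 hs
  have hg : 0 < 1 - 2 * lam := by linarith
  -- Agreement below `m` fixes about `ρ * m` free digits, and `2 ^ (-(ρ * m)) = (lam ^ m) ^ (ρ *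
  -- s)`; hence the Hölder exponent.
  set r : ℝ≥0 := ⟨ρ * s, by positivity⟩
  have hrpos : 0 < r := NNReal.coe_pos.1 (show (0 : ℝ) < ρ * s by positivity)
  set C : ℝ≥0 := ⟨2 ^ c / (1 - 2 * lam) ^ (ρ * s), by positivity⟩
  have hmain : ∀ d e : ℕ → Fin 2, dist (Real.ofDigits d) (Real.ofDigits e) ≤
      C * dist (cantorPoint lam (spreadDigits p d)) (cantorPoint lam (spreadDigits p e)) ^
        (r : ℝ) := by
    intro d e
    by_cases hne : ∃ i, spreadDigits p d i ≠ spreadDigits p e i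
    · classical
      set m := Nat.find hne
      have hm : spreadDigits p d m ≠ spreadDigits p e m := Nat.find_spec hne
      have hlt : ∀ i < m, spreadDigits p d i = spreadDigits p e i := fun i hi =>
        not_not.1 (Nat.find_min hne hi)
      have hdist := le_dist_cantorPoint h0 h1 hlt hm
      set D := dist (cantorPoint lam (spreadDigits p d)) (cantorPoint lam (spreadDigits p e))
      calc dist (Real.ofDigits d) (Real.ofDigits e)
          ≤ (((2 : ℕ) : ℝ) ^ Nat.count p m)⁻¹ :=
            Real.abs_ofDigits_sub_ofDigits_le fun i hi => eq_of_spreadDigits_eq hlt hi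
        _ = 2 ^ (-(Nat.count p m : ℝ)) := by
            rw [Real.rpow_neg two_pos.le, Real.rpow_natCast]
            norm_num
        _ ≤ 2 ^ (c + -(ρ * m)) :=
            Real.rpow_le_rpow_of_exponent_le one_le_two (by linarith [hcount m])
        _ = 2 ^ c * (lam ^ m) ^ (ρ * s) := by
            rw [Real.rpow_add two_pos, ← Real.rpow_natCast, ← Real.rpow_mul h0.le,
              show (m : ℝ) * (ρ * s) = s * (ρ * m) by ring, Real.rpow_mul h0.le,
              rpow_eq_half h0 h1 hs, one_div, Real.inv_rpow two_pos.le, Real.rpow_neg two_pos.le]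
        _ ≤ 2 ^ c * (D / (1 - 2 * lam)) ^ (ρ * s) := by
            gcongr
            rwa [le_div_iff₀ hg]
        _ = C * D ^ (r : ℝ) := by
            rw [Real.div_rpow dist_nonneg hg.le]
            change _ = 2 ^ c / (1 - 2 * lam) ^ (ρ * s) * D ^ (ρ * s)
            ring
    · push Not at hne
      -- The count of free positions is unbounded, so every digit of `d` and `e` is visible.
      have hde : d = e := by
        funext j
        obtain ⟨m, hm⟩ := exists_nat_gt ((j + c) / ρ)
        rw [div_lt_iff₀' hρ] at hm
        have hj : (j : ℝ) < Nat.count p m := by linarith [hcount m]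
        exact eq_of_spreadDigits_eq (fun i _ => hne i) (Nat.cast_lt.1 hj)
      rw [hde, dist_self]
      positivity
  have hdim := mul_dimH_range_le hrpos hmain
  have hone : 1 ≤ dimH (Set.range (Real.ofDigits : (ℕ → Fin 2) → ℝ)) := by
    calc (1 : ℝ≥0∞) = dimH (Set.Icc (0 : ℝ) 1) := by
          rw [Real.dimH_of_nonempty_interior (by simp)]
          simp
      _ ≤ _ := dimH_mono fun x hx => by
          obtain ⟨d, -, hd⟩ := Real.ofDigits_SurjOn one_lt_two hx
          exact ⟨d, hd⟩
  calc ENNReal.ofReal (ρ * s) = r := by rw [← ENNReal.ofReal_coe_nnreal]; rfl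
    _ ≤ r * dimH (Set.range (Real.ofDigits : (ℕ → Fin 2) → ℝ)) := le_mul_of_one_le_right' hone
    _ ≤ _ := hdim

/-- Each `M > t` gives the bound `(1 - t / M) / t * s`: sparser blocks waste fewer digits, and the
limit in `M` is `s / t`. -/
theorem le_dimH_approximableSet (h0 : 0 < lam) (h1 : lam < 1 / 2)
    (hs : s = -Real.log 2 / Real.log lam) {P : ℕ → Set ℝ} {N : ℕ → ℕ}
    (hPN : ∀ q : ℕ, 1 ≤ q → P q ⊆ cantorLeftEndpoints lam (N q) ∧ lam ^ N q < 1 / q ∧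
      lam * (1 / q) ≤ lam ^ N q ∧
      (((cantorLeftEndpoints lam (N q)).Pairwise fun x y => 1 / (q : ℝ) ≤ dist x y) →
        P q = cantorLeftEndpoints lam (N q)))
    {t : ℝ} (ht : 1 ≤ t) :
    ENNReal.ofReal (s / t) ≤ dimH (approximableSet (centralCantorSet lam) P t) := by
  classical
  have ht0 : 0 < t := by linarith
  have hlim : Tendsto (fun M : ℕ => ENNReal.ofReal ((1 - t / M) / t * s)) atTop
      (𝓝 (ENNReal.ofReal (s / t))) := by
    refine ENNReal.tendsto_ofReal ?_
    have := (((tendsto_const_div_atTop_nhds_zero_nat t).const_sub 1).div_const t).mul_const s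
    convert this using 2
    ring
  refine le_of_tendsto hlim ?_
  filter_upwards [eventually_ge_atTop 2, eventually_gt_atTop ⌈t⌉₊] with M hM htM
  have htM' : t < M := Nat.lt_of_ceil_lt htM
  have hM0 : (0 : ℝ) < M := by linarith
  have hρ : 0 < (1 - t / M) / t := div_pos (sub_pos.2 ((div_lt_one hM0).2 htM')) ht0
  refine (le_dimH_range_cantorPoint_spreadDigits h0 h1 hs hρ
    (le_count_isFreePosition hM ht htM'.le)).trans (dimH_mono ?_)
  rintro _ ⟨d, rfl⟩
  exact cantorPoint_spreadDigits_mem h0 h1 hPN ht hM d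

/-- Every point of `F` is within `1 / q` of a maximal `(1 / q)`-separated subset of `F`. -/
theorem approximableSet_one {X : Type*} [MetricSpace X] {F : Set X} {P : ℕ → Set X}
    (hP : IsAbstractRationals F P) : approximableSet F P 1 = F := by
  refine Set.Subset.antisymm (fun x hx => hx.1) fun x hx => ⟨hx, Eventually.frequently ?_⟩
  filter_upwards [eventually_ge_atTop 1] with q hq
  obtain ⟨⟨hPF, hsep⟩, hmax⟩ := hP q hq
  rw [Real.rpow_one]
  by_contra! hfar
  have hmem : x ∈ P q := by
    refine hmax ⟨Set.insert_subset hx hPF, hsep.insert fun b hb _ => ?_⟩ (Set.subset_insert x _)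
      (Set.mem_insert x _)
    exact ⟨dist_comm b x ▸ (hfar b hb).le, (hfar b hb).le⟩
  have := hfar x hmem
  rw [dist_self] at this
  exact absurd this (not_lt.2 (by positivity))

end Dimension

theorem mainTheorem10 (lam s : ℝ) (hlam0 : 0 < lam) (hlam1 : lam < 1 / 2)
    (hs : s = -Real.log 2 / Real.log lam) :
    dimH (centralCantorSet lam) = ENNReal.ofReal s ∧
    ∃ P : ℕ → Set ℝ,
      IsAbstractRationals (centralCantorSet lam) P ∧
      (∀ q : ℕ, 1 ≤ q → P q ⊆ cantorEndpoints lam) ∧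
      ∀ t : ℝ, 1 ≤ t →
        dimH (approximableSet (centralCantorSet lam) P t) = ENNReal.ofReal (s / t) := by
  obtain ⟨P, N, hP, hPN⟩ := exists_abstractRationals hlam0 hlam1
  have hdim : ∀ t : ℝ, 1 ≤ t →
      dimH (approximableSet (centralCantorSet lam) P t) = ENNReal.ofReal (s / t) := fun t ht =>
    le_antisymm
      (dimH_approximableSet_le hlam0 hlam1 hs
        (fun q hq => ⟨(hPN q hq).1, (hPN q hq).2.1, (hPN q hq).2.2.1⟩) ht)
      (le_dimH_approximableSet hlam0 hlam1 hs hPN ht)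
  refine ⟨?_, P, hP, fun q hq a ha => ?_, hdim⟩
  · rw [← approximableSet_one hP, hdim 1 le_rfl, div_one]
  · simp only [cantorEndpoints, Set.mem_iUnion]
    exact ⟨N q, a, (hPN q hq).1 ha, Or.inl rfl⟩
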